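/- Let $U:=L^2([0,12];\mathbb R)\times L^2([0,12];\mathbb R)$ and consider the free-flying robot problem $$ (P3)\quad \min_{u\in U}\ \varphi(u):=\int_0^{12}\big(u_1^2(t)+u_2^2(t)\big)\,dt $$ subject to the existence of a state $x=(x_1,\dots,x_6)\in W^{1,2}([0,12];\mathbb R^6)$ satisfying, for a.e. $t\in[0,12]$, $$ \dot x_1=x_4,\quad \dot x_2=x_5,\quad \dot x_3=x_6,\quad \dot x_4=(u_1+u_2)\cos x_3,\quad \dot x_5=(u_1+u_2)\sin x_3,\quad \dot x_6=0.2\,(u_1-u_2), $$ with $x(0)=(-10,-10,\pi/2,0,0,0)$ and $x(12)=0$, and subject to $u\in K_2:=\{u\in U:\ |u_1(t)|\le 0.8,\ |u_2(t)|\le 0.4\ \text{for a.e. } t\in[0,12]\}$. For $u\in U$ and $t\in[0,12]$ put $$ \begin{aligned} G_6(t)&=\int_0^t 0.2\,(u_1-u_2)\,ds, & G_3(t)&=\frac{\pi}{2}+\int_0^t G_6\,dr,\\ G_5(t)&=\int_0^t (u_1+u_2)\sin G_3\,ds, & G_4(t)&=\int_0^t (u_1+u_2)\cos G_3\,ds,\\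 G_2(t)&=-10+\int_0^t G_5\,dr, & G_1(t)&=-10+\int_0^t G_4\,dr, \end{aligned} $$ and let $h:U\to\mathbb R^6$, $h(u):=(G_1(12),\dots,G_6(12))$. For a set $C$ let $\delta_C$ be $0$ on $C$ and $+\infty$ off $C$, with $\delta_z:=\delta_{\{z\}}$ for a point $z$, and define $f:U\times\mathbb R^6\to\mathbb R\cup\{+\infty\}$ by $$ f(u,z):=\varphi(u)+\delta_{h^{-1}(z)\cap K_2}(u). $$ Then, for $u\in U$, $h(u)=0$ if and only if some $x\in W^{1,2}([0,12];\mathbb R^6)$ satisfies the above differential equations and boundary conditions; $f(u,z)=\varphi(u)+\delta_z(h(u))+\delta_{K_2}(u)$ for all $(u,z)$; $f$ is a dualizing parametrization of $(P3)$, that is, $f(u,0)=\varphi(u)$ if $u$ is feasible for $(P3)$ and $f(u,0)=+\infty$ otherwise; and the following assumptions hold. - **(H0)** $\varphi$ is proper (never $-\infty$, not identically $+\infty$) and weakly lower semicontinuous. - **(H1)** For every $\alpha\in\mathbb R$ the level set $\{u\in U:\varphi(u)\le\alpha\}$ is weakly compact. - **(H2)** $f$ is proper, weakly lower semicontinuous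 on $U\times\mathbb R^6$, and weakly level-compact: for every $\bar z\in\mathbb R^6$ and $\alpha\in\mathbb R$ there are a weakly open neighbourhood $V$ of $\bar z$ and a weakly compact set $B\subset U$ such that $\{u\in U: f(u,z)\le\alpha\}\subset B$ for all $z\in V$. -/

import Mathlib

open MeasureTheory Set

noncomputable section

/-! ### Weak topology and extended-real-valued functions

Values in `ℝ ∪ {±∞}` are taken in `EReal`.  The weak topology of a normed space `X` is the topology
of Mathlib's type synonym `WeakSpace ℝ X`. -/

section Framework

variable {X : Type*} [NormedAddCommGroup X] [NormedSpace ℝ X]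

/-- `g` is proper: it never takes the value `-∞` and its effective domain is nonempty. -/
def IsProperFun {S : Type*} (g : S → EReal) : Prop :=
  (∀ x, g x ≠ ⊥) ∧ ∃ x, g x < ⊤

/-- `g` is lower semicontinuous for the weak topology of `X`. -/
def WeaklyLSC (g : X → EReal) : Prop :=
  LowerSemicontinuous fun x : WeakSpace ℝ X => g ((toWeakSpace ℝ X).symm x)

/-- `A` is compact for the weak topology of `X`. -/
def IsWeaklyCompact (A : Set X) : Prop :=
  IsCompact (toWeakSpace ℝ X '' A)

/-- `V` is open for the weak topology of `X`. -/
def IsWeaklyOpen (V : Set X) : Prop :=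
  IsOpen (toWeakSpace ℝ X '' V)

open Classical in
/-- The indicator function `δ_C`: `0` on `C` and `+∞` off `C`. -/
def indicatorFun {S : Type*} (C : Set S) (x : S) : EReal :=
  if x ∈ C then 0 else ⊤

variable {H : Type*} [NormedAddCommGroup H] [NormedSpace ℝ H]

/-- `f` is weakly level-compact: every `z₀` has, for every level `α`, a weakly open neighbourhood on
which all the level sets `{u | f (u, z) ≤ α}` stay inside one weakly compact set. -/
def WeaklyLevelCompact (f : X × H → EReal) : Prop :=
  ∀ (z₀ : H) (α : ℝ), ∃ V : Set H, IsWeaklyOpen V ∧ z₀ ∈ V ∧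
    ∃ B : Set X, IsWeaklyCompact B ∧ ∀ z ∈ V, {u : X | f (u, z) ≤ (α : EReal)} ⊆ B

/-- (H0): the objective function is proper and weakly lower semicontinuous. -/
def AssumptionH0 (φ : X → EReal) : Prop :=
  IsProperFun φ ∧ WeaklyLSC φ

/-- (H1): all level sets of the objective function are weakly compact. -/
def AssumptionH1 (φ : X → EReal) : Prop :=
  ∀ α : ℝ, IsWeaklyCompact {u : X | φ u ≤ (α : EReal)}

/-- (H2): the dualizing parametrization is proper, weakly lower semicontinuous on the product space
(jointly in both variables), and weakly level-compact. -/
def AssumptionH2 (f : X × H → EReal) : Prop :=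
  IsProperFun f ∧ WeaklyLSC f ∧ WeaklyLevelCompact f

/-- `f` is a dualizing parametrization of the problem `min φ(u)` subject to `u ∈ A`, which is the
problem of minimizing `φ + δ_A` over the whole space. -/
def IsDualizingParametrization (φ : X → EReal) (A : Set X) (f : X × H → EReal) : Prop :=
  ∀ u, f (u, 0) = φ u + indicatorFun A u

end Framework

/-! ### The free-flying robot problem -/

namespace FFR

/-- Lebesgue measure on the time interval `[0, 12]`. -/
abbrev timeMeasure : Measure ℝ := volume.restrict (Icc (0 : ℝ) 12)

/-- `L²([0, 12]; ℝ)`. -/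
abbrev L2 : Type := Lp ℝ 2 timeMeasure

/-- The control space `L²([0, 12]; ℝ) × L²([0, 12]; ℝ)`. -/
abbrev Control : Type := L2 × L2

/-- The parameter space `ℝ⁶`. -/
abbrev Param : Type := EuclideanSpace ℝ (Fin 6)

/-- The objective function `φ(u) = ∫₀¹² (u₁² + u₂²) dt`. -/
def objective (u : Control) : EReal :=
  ((∫ t in (0 : ℝ)..12, ((u.1 t) ^ 2 + (u.2 t) ^ 2) : ℝ) : EReal)

/-- The box constraint set `K₂`; elements of `L²` are classes modulo null sets, so the pointwise
bounds are required for almost every time. -/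
def box : Set Control :=
  {u | ∀ᵐ t ∂timeMeasure, |u.1 t| ≤ 0.8 ∧ |u.2 t| ≤ 0.4}

/-- The Sobolev space `W^{1,2}([0, 12]; ℝ)`: absolutely continuous functions with square integrable
derivative. -/
def IsW12 (y : ℝ → ℝ) : Prop :=
  AbsolutelyContinuousOnInterval y 0 12 ∧ MemLp (deriv y) 2 timeMeasure

/-- The boundary value problem for the state `x = (x₁, …, x₆)` driven by the control `u`, with
`x i` for `i = 0, …, 5` the component usually written `x_{i+1}`. -/
structure IsTrajectory (u : Control) (x : Fin 6 → ℝ → ℝ) : Prop where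
  sobolev : ∀ i, IsW12 (x i)
  ode₁ : ∀ᵐ t ∂timeMeasure, HasDerivAt (x 0) (x 3 t) t
  ode₂ : ∀ᵐ t ∂timeMeasure, HasDerivAt (x 1) (x 4 t) t
  ode₃ : ∀ᵐ t ∂timeMeasure, HasDerivAt (x 2) (x 5 t) t
  ode₄ : ∀ᵐ t ∂timeMeasure, HasDerivAt (x 3) ((u.1 t + u.2 t) * Real.cos (x 2 t)) t
  ode₅ : ∀ᵐ t ∂timeMeasure, HasDerivAt (x 4) ((u.1 t + u.2 t) * Real.sin (x 2 t)) t
  ode₆ : ∀ᵐ t ∂timeMeasure, HasDerivAt (x 5) (0.2 * (u.1 t - u.2 t)) t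
  initial : ∀ i, x i 0 = ![-10, -10, Real.pi / 2, 0, 0, 0] i
  final : ∀ i, x i 12 = 0

/-- The controls that are feasible for the free-flying robot problem. -/
def feasible : Set Control :=
  {u | u ∈ box ∧ ∃ x, IsTrajectory u x}

/-- `G₆(t) = ∫₀ᵗ 0.2 (u₁ - u₂) ds`. -/
def G₆ (u : Control) (t : ℝ) : ℝ := ∫ s in (0 : ℝ)..t, 0.2 * (u.1 s - u.2 s)

/-- `G₃(t) = π/2 + ∫₀ᵗ ∫₀ʳ 0.2 (u₁ - u₂) ds dr`. -/
def G₃ (u : Control) (t : ℝ) : ℝ := Real.pi / 2 + ∫ r in (0 : ℝ)..t, G₆ u r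

/-- `G₅(t) = ∫₀ᵗ (u₁ + u₂) sin G₃ ds`. -/
def G₅ (u : Control) (t : ℝ) : ℝ := ∫ s in (0 : ℝ)..t, (u.1 s + u.2 s) * Real.sin (G₃ u s)

/-- `G₄(t) = ∫₀ᵗ (u₁ + u₂) cos G₃ ds`. -/
def G₄ (u : Control) (t : ℝ) : ℝ := ∫ s in (0 : ℝ)..t, (u.1 s + u.2 s) * Real.cos (G₃ u s)

/-- `G₂(t) = -10 + ∫₀ᵗ G₅ dr`. -/
def G₂ (u : Control) (t : ℝ) : ℝ := -10 + ∫ r in (0 : ℝ)..t, G₅ u r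

/-- `G₁(t) = -10 + ∫₀ᵗ G₄ dr`. -/
def G₁ (u : Control) (t : ℝ) : ℝ := -10 + ∫ r in (0 : ℝ)..t, G₄ u r

/-- The constraint function `h(u) = (G₁(12), …, G₆(12))`. -/
def h (u : Control) : Param :=
  !₂[G₁ u 12, G₂ u 12, G₃ u 12, G₄ u 12, G₅ u 12, G₆ u 12]

/-- The parametrization `f(u, z) = φ(u) + δ_{h⁻¹(z) ∩ K₂}(u)`. -/
def parametrization (p : Control × Param) : EReal :=
  objective p.1 + indicatorFun (h ⁻¹' {p.2} ∩ box) p.1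

end FFR

end

/-!
The objective is `‖u₁‖² + ‖u₂‖²`, so its level sets are convex, norm closed and bounded in a product
of two Hilbert spaces. By Mazur's theorem (`isClosed_toWeakSpace_image`) and Banach–Alaoglu together
with Riesz representation (`isWeaklyCompact_prod_closedBall`) they are weakly compact. This gives
(H0), (H1) and the weak level-compactness in (H2).

The equivalence of `h u = 0` with the boundary value problem rests on the fundamental theorem of
calculus for absolutely continuous functions: primitives of `L²` functions lie in `W^{1,2}` and solve
the differential equations almost everywhere (`isW12_primitive`, `ae_hasDerivAt_primitive`), and
conversely the triangular structure of the system identifies every trajectory with the functions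
`G₁, …, G₆` on `[0, 12]` (`eq_primitive_of_ae_hasDerivAt`).

The remaining point is the weak lower semicontinuity of the parametrization, that is, the weak
closedness of the graph of `h` over the weakly closed sets `{φ ≤ α} ∩ K₂`. It follows from weak
continuity of `h` on the box (`tendsto_h`). Let a filter of controls in the box converge weakly.
Then `G₆`, being linear in the control, converges pointwise; as the bounds in the box make all these
functions Lipschitz with a common constant, the convergence is uniform
(`tendstoUniformlyOn_of_lipschitz`), and hence so is that of `G₃`. In `∫ (u₁ + u₂) cos G₃` the
argument of the cosine may thus be replaced by its limit at a uniformly small cost, after which the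
integral is a continuous linear functional of the control (`tendsto_velocity`). The same argument
applies to the sine. A second use of the common Lipschitz constant makes the convergence of `G₄`, `G₅`
uniform, and integration carries it over to `G₁`, `G₂`.
-/

open Filter Topology

/-! ### Weak topologies -/

section Weak

variable {X : Type*} [NormedAddCommGroup X] [NormedSpace ℝ X]

theorem continuous_weakSpace_eval (l : StrongDual ℝ X) :
    Continuous fun x : WeakSpace ℝ X => l ((toWeakSpace ℝ X).symm x) :=
  WeakBilin.eval_continuous (topDualPairing ℝ X).flip l

/-- Mazur's theorem: a norm closed convex set is weakly closed. -/
theorem isClosed_toWeakSpace_image {A : Set X} (hconv : Convex ℝ A) (hcl : IsClosed A) :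
    IsClosed (toWeakSpace ℝ X '' A) := by
  rw [← hcl.closure_eq, hconv.toWeakSpace_closure (𝕜 := ℝ)]
  exact isClosed_closure

theorem weaklyLSC_of_isClosed {g : X → EReal}
    (hg : ∀ α : ℝ, IsClosed (toWeakSpace ℝ X '' {x | g x ≤ (α : EReal)}))
    (hbot : ∀ x, g x ≠ ⊥) : WeaklyLSC g := by
  unfold WeaklyLSC
  rw [lowerSemicontinuous_iff_isClosed_preimage]
  intro y
  induction y with
  | bot =>
    convert isClosed_empty
    ext x
    simp [hbot]
  | coe α =>
    convert hg α
    ext x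
    simp only [mem_preimage, mem_Iic, mem_image, mem_ofPred_eq]
    exact ⟨fun hx => ⟨_, hx, LinearEquiv.apply_symm_apply _ _⟩, by
      rintro ⟨x', hx', rfl⟩
      simpa using hx'⟩
  | top =>
    convert isClosed_univ
    ext x
    simp

theorem isWeaklyCompact_of_subset {A B : Set X} (hB : IsWeaklyCompact B) (hAB : A ⊆ B)
    (hA : IsClosed (toWeakSpace ℝ X '' A)) : IsWeaklyCompact A :=
  hB.of_isClosed_subset hA (image_mono hAB)

/-- Products of closed balls of Hilbert spaces are weakly compact, by the Banach–Alaoglu theorem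
and the Riesz representation theorem. -/
theorem isWeaklyCompact_prod_closedBall {E F : Type*} [NormedAddCommGroup E]
    [InnerProductSpace ℝ E] [CompleteSpace E] [NormedAddCommGroup F] [InnerProductSpace ℝ F]
    [CompleteSpace F] (r : ℝ) :
    IsWeaklyCompact (Metric.closedBall (0 : E) r ×ˢ Metric.closedBall (0 : F) r) := by
  let Φ : WeakDual ℝ E × WeakDual ℝ F → WeakSpace ℝ (E × F) := fun p =>
    toWeakSpace ℝ (E × F) ((InnerProductSpace.toDual ℝ E).symm (WeakDual.toStrongDual p.1),
      (InnerProductSpace.toDual ℝ F).symm (WeakDual.toStrongDual p.2))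
  have hΦ : Continuous Φ := by
    refine WeakBilin.continuous_of_continuous_eval _ fun l => ?_
    -- a functional on the product is the sum of two functionals, each an inner product
    have key : ∀ p : WeakDual ℝ E × WeakDual ℝ F,
        (topDualPairing ℝ (E × F)).flip (Φ p) l =
          p.1 ((InnerProductSpace.toDual ℝ E).symm (l.comp (ContinuousLinearMap.inl ℝ E F))) +
          p.2 ((InnerProductSpace.toDual ℝ F).symm (l.comp (ContinuousLinearMap.inr ℝ E F))) := by
      intro p
      have hsplit : ∀ (a : E) (b : F), l (a, b) =
          l.comp (ContinuousLinearMap.inl ℝ E F) a + l.comp (ContinuousLinearMap.inr ℝ E F) b := by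
        intro a b
        simp [← map_add]
      have h1 : ∀ (q : WeakDual ℝ E) (m : StrongDual ℝ E),
          m ((InnerProductSpace.toDual ℝ E).symm (WeakDual.toStrongDual q)) =
            q ((InnerProductSpace.toDual ℝ E).symm m) := by
        intro q m
        rw [← InnerProductSpace.toDual_symm_apply (y := m), real_inner_comm,
          InnerProductSpace.toDual_symm_apply]
        rfl
      have h2 : ∀ (q : WeakDual ℝ F) (m : StrongDual ℝ F),
          m ((InnerProductSpace.toDual ℝ F).symm (WeakDual.toStrongDual q)) =
            q ((InnerProductSpace.toDual ℝ F).symm m) := by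
        intro q m
        rw [← InnerProductSpace.toDual_symm_apply (y := m), real_inner_comm,
          InnerProductSpace.toDual_symm_apply]
        rfl
      rw [← h1, ← h2, ← hsplit]
      rfl
    simp only [key]
    exact ((WeakDual.eval_continuous _).comp continuous_fst).add
      ((WeakDual.eval_continuous _).comp continuous_snd)
  have hK := ((WeakDual.isCompact_closedBall (𝕜 := ℝ) (E := E) 0 r).prod
    (WeakDual.isCompact_closedBall (𝕜 := ℝ) (E := F) 0 r)).image hΦ
  unfold IsWeaklyCompact
  convert hK using 1
  ext x
  constructor
  · rintro ⟨⟨a, b⟩, ⟨ha, hb⟩, rfl⟩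
    refine ⟨(StrongDual.toWeakDual (InnerProductSpace.toDual ℝ E a),
      StrongDual.toWeakDual (InnerProductSpace.toDual ℝ F b)), ⟨?_, ?_⟩, ?_⟩
    · simpa using ha
    · simpa using hb
    · simp [Φ]
  · rintro ⟨⟨p, q⟩, ⟨hp, hq⟩, rfl⟩
    refine ⟨_, ⟨?_, ?_⟩, rfl⟩
    · simpa using hp
    · simpa using hq

end Weak

namespace FFR

/-! ### Primitives of square integrable functions -/

section Primitive

variable {g : ℝ → ℝ}

theorem intervalIntegrable_of_memLp (hg : MemLp g 2 timeMeasure) {s t : ℝ}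
    (hs : s ∈ Icc (0 : ℝ) 12) (ht : t ∈ Icc (0 : ℝ) 12) : IntervalIntegrable g volume s t := by
  have hint : IntegrableOn g (Icc 0 12) := hg.integrable (by norm_num)
  exact (hint.mono_set (uIcc_subset_Icc hs ht)).intervalIntegrable

theorem absolutelyContinuous_primitive (hg : MemLp g 2 timeMeasure) (c : ℝ) :
    AbsolutelyContinuousOnInterval (fun t => c + ∫ s in (0 : ℝ)..t, g s) 0 12 := by
  have h0 : (0 : ℝ) ∈ Icc (0 : ℝ) 12 := by simp
  have h12 : (12 : ℝ) ∈ Icc (0 : ℝ) 12 := by simp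
  have hconst : AbsolutelyContinuousOnInterval (fun _ : ℝ => c) 0 12 :=
    ((LipschitzWith.const c).lipschitzOnWith (s := uIcc 0 12)).absolutelyContinuousOnInterval
  exact hconst.add ((intervalIntegrable_of_memLp hg h0
    h12).absolutelyContinuousOnInterval_intervalIntegral (by simp))

theorem continuousOn_primitive (hg : MemLp g 2 timeMeasure) (c : ℝ) :
    ContinuousOn (fun t => c + ∫ s in (0 : ℝ)..t, g s) (Icc 0 12) := by
  have := (absolutelyContinuous_primitive hg c).continuousOn
  rwa [uIcc_of_le (by norm_num)] at this

theorem ae_hasDerivAt_primitive (hg : MemLp g 2 timeMeasure) (c : ℝ) :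
    ∀ᵐ t ∂timeMeasure, HasDerivAt (fun t => c + ∫ s in (0 : ℝ)..t, g s) (g t) t := by
  have h0 : (0 : ℝ) ∈ Icc (0 : ℝ) 12 := by simp
  have h12 : (12 : ℝ) ∈ Icc (0 : ℝ) 12 := by simp
  rw [ae_restrict_iff' measurableSet_Icc]
  filter_upwards [(intervalIntegrable_of_memLp hg h0 h12).ae_hasDerivAt_integral] with t ht htI
  rw [uIcc_of_le (by norm_num)] at ht
  exact (ht htI 0 h0).const_add c

theorem isW12_primitive (hg : MemLp g 2 timeMeasure) (c : ℝ) :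
    IsW12 (fun t => c + ∫ s in (0 : ℝ)..t, g s) := by
  refine ⟨absolutelyContinuous_primitive hg c, hg.ae_eq ?_⟩
  filter_upwards [ae_hasDerivAt_primitive hg c] with t ht
  exact ht.deriv.symm

/-- An absolutely continuous function is recovered from its almost everywhere derivative. -/
theorem eq_primitive_of_ae_hasDerivAt {y : ℝ → ℝ} (hy : AbsolutelyContinuousOnInterval y 0 12)
    (hd : ∀ᵐ t ∂timeMeasure, HasDerivAt y (g t) t) {t : ℝ} (ht : t ∈ Icc (0 : ℝ) 12) :
    y t = y 0 + ∫ s in (0 : ℝ)..t, g s := by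
  have hsub : uIcc 0 t ⊆ uIcc (0 : ℝ) 12 := by
    rw [uIcc_of_le ht.1, uIcc_of_le (by norm_num)]
    exact Icc_subset_Icc_right ht.2
  have hFTC := (hy.mono hsub).integral_deriv_eq_sub
  have hcongr : ∫ s in (0 : ℝ)..t, deriv y s = ∫ s in (0 : ℝ)..t, g s := by
    refine intervalIntegral.integral_congr_ae ?_
    rw [ae_restrict_iff' measurableSet_Icc] at hd
    filter_upwards [hd] with s hs hst
    rw [uIoc_of_le ht.1] at hst
    exact (hs ⟨hst.1.le, hst.2.trans ht.2⟩).deriv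
  rw [← hcongr, hFTC]
  ring

theorem memLp_of_continuousOn {f : ℝ → ℝ} (hf : ContinuousOn f (Icc 0 12)) :
    MemLp f 2 timeMeasure := by
  obtain ⟨C, hC⟩ := isCompact_Icc.exists_bound_of_continuousOn hf
  refine MemLp.of_bound (hf.aestronglyMeasurable measurableSet_Icc) C ?_
  rw [ae_restrict_iff' measurableSet_Icc]
  exact Eventually.of_forall hC

theorem memLp_mul_of_continuousOn {f : ℝ → ℝ} (hg : MemLp g 2 timeMeasure)
    (hf : ContinuousOn f (Icc 0 12)) : MemLp (fun t => g t * f t) 2 timeMeasure := by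
  obtain ⟨C, hC⟩ := isCompact_Icc.exists_bound_of_continuousOn hf
  have hfm := hf.aestronglyMeasurable measurableSet_Icc (μ := volume)
  refine MemLp.of_le_mul (c := C) hg (hg.aestronglyMeasurable.mul hfm) ?_
  rw [ae_restrict_iff' measurableSet_Icc]
  refine Eventually.of_forall fun t ht => ?_
  rw [norm_mul, mul_comm]
  exact mul_le_mul_of_nonneg_right (hC t ht) (norm_nonneg _)

theorem abs_integral_le_of_ae {C s t : ℝ} (hb : ∀ᵐ r ∂timeMeasure, |g r| ≤ C)
    (hs : s ∈ Icc (0 : ℝ) 12) (ht : t ∈ Icc (0 : ℝ) 12) :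
    |∫ r in s..t, g r| ≤ C * |t - s| := by
  refine intervalIntegral.norm_integral_le_of_norm_le_const_ae (f := g) ?_
  rw [ae_restrict_iff' measurableSet_Icc] at hb
  filter_upwards [hb] with r hr hrst
  exact hr (uIcc_subset_Icc hs ht (uIoc_subset_uIcc hrst))

theorem abs_primitive_sub_le {C : ℝ} (hg : MemLp g 2 timeMeasure)
    (hb : ∀ᵐ r ∂timeMeasure, |g r| ≤ C) {s t : ℝ}
    (hs : s ∈ Icc (0 : ℝ) 12) (ht : t ∈ Icc (0 : ℝ) 12) :
    |(∫ r in (0 : ℝ)..t, g r) - ∫ r in (0 : ℝ)..s, g r| ≤ C * |t - s| := by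
  have h0 : (0 : ℝ) ∈ Icc (0 : ℝ) 12 := by simp
  rw [intervalIntegral.integral_interval_sub_left (intervalIntegrable_of_memLp hg h0 ht)
    (intervalIntegrable_of_memLp hg h0 hs)]
  exact abs_integral_le_of_ae hb hs ht

end Primitive

/-! ### The state equations -/

section State

variable (u : Control)

/-- The angular acceleration. -/
theorem memLp_turning : MemLp (fun t => 0.2 * (u.1 t - u.2 t)) 2 timeMeasure :=
  ((Lp.memLp u.1).sub (Lp.memLp u.2)).const_mul 0.2

theorem memLp_thrust : MemLp (fun t => u.1 t + u.2 t) 2 timeMeasure :=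
  (Lp.memLp u.1).add (Lp.memLp u.2)

theorem continuousOn_G₆ : ContinuousOn (G₆ u) (Icc 0 12) := by
  simpa only [zero_add] using! continuousOn_primitive (memLp_turning u) 0

theorem continuousOn_G₃ : ContinuousOn (G₃ u) (Icc 0 12) :=
  continuousOn_primitive (memLp_of_continuousOn (continuousOn_G₆ u)) _

/-- `∫₀ᵗ (u₁ + u₂) σ(G₃) ds`: the velocity component `G₄` for `σ = cos` and `G₅` for `σ = sin`. -/
noncomputable def velocity (σ : ℝ → ℝ) (u : Control) (t : ℝ) : ℝ :=
  ∫ s in (0 : ℝ)..t, (u.1 s + u.2 s) * σ (G₃ u s)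

variable {σ : ℝ → ℝ}

theorem memLp_acceleration (hσ : Continuous σ) :
    MemLp (fun t => (u.1 t + u.2 t) * σ (G₃ u t)) 2 timeMeasure :=
  memLp_mul_of_continuousOn (memLp_thrust u) (hσ.comp_continuousOn (continuousOn_G₃ u))

theorem continuousOn_velocity (hσ : Continuous σ) :
    ContinuousOn (velocity σ u) (Icc 0 12) := by
  simpa only [zero_add] using! continuousOn_primitive (memLp_acceleration u hσ) 0

theorem h_eq_zero_iff : h u = 0 ↔ G₁ u 12 = 0 ∧ G₂ u 12 = 0 ∧ G₃ u 12 = 0 ∧ G₄ u 12 = 0 ∧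
    G₅ u 12 = 0 ∧ G₆ u 12 = 0 := by
  rw [PiLp.ext_iff]
  simp [h, Fin.forall_fin_succ]

theorem exists_isTrajectory_of_h_eq_zero (hu : h u = 0) : ∃ x, IsTrajectory u x := by
  obtain ⟨h1, h2, h3, h4, h5, h6⟩ := (h_eq_zero_iff u).1 hu
  have m4 := memLp_of_continuousOn (continuousOn_velocity u Real.continuous_cos)
  have m5 := memLp_of_continuousOn (continuousOn_velocity u Real.continuous_sin)
  have m6 := memLp_of_continuousOn (continuousOn_G₆ u)
  have a4 := memLp_acceleration u Real.continuous_cos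
  have a5 := memLp_acceleration u Real.continuous_sin
  have a6 := memLp_turning u
  have e4 : G₄ u = fun t => 0 + ∫ s in (0 : ℝ)..t, (u.1 s + u.2 s) * Real.cos (G₃ u s) := by
    funext t; simp [G₄]
  have e5 : G₅ u = fun t => 0 + ∫ s in (0 : ℝ)..t, (u.1 s + u.2 s) * Real.sin (G₃ u s) := by
    funext t; simp [G₅]
  have e6 : G₆ u = fun t => 0 + ∫ s in (0 : ℝ)..t, 0.2 * (u.1 s - u.2 s) := by
    funext t; simp [G₆]
  refine ⟨![G₁ u, G₂ u, G₃ u, G₄ u, G₅ u, G₆ u], ?_, ?_, ?_, ?_, ?_, ?_, ?_, ?_, ?_⟩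
  · intro i
    fin_cases i
    · exact isW12_primitive m4 _
    · exact isW12_primitive m5 _
    · exact isW12_primitive m6 _
    · exact e4 ▸ isW12_primitive a4 _
    · exact e5 ▸ isW12_primitive a5 _
    · exact e6 ▸ isW12_primitive a6 _
  · exact ae_hasDerivAt_primitive m4 _
  · exact ae_hasDerivAt_primitive m5 _
  · exact ae_hasDerivAt_primitive m6 _
  · have := ae_hasDerivAt_primitive a4 0
    rwa [← e4] at this
  · have := ae_hasDerivAt_primitive a5 0
    rwa [← e5] at this
  · have := ae_hasDerivAt_primitive a6 0
    rwa [← e6] at this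
  · intro i
    fin_cases i <;> simp [G₁, G₂, G₃, G₄, G₅, G₆]
  · intro i
    fin_cases i <;> simp [h1, h2, h3, h4, h5, h6]

/-- The system is triangular, so its components are determined one after another by integration:
the angular velocity, the orientation, the velocity and the position. -/
theorem h_eq_zero_of_isTrajectory {x : Fin 6 → ℝ → ℝ} (hx : IsTrajectory u x) : h u = 0 := by
  have hac := fun i => (hx.sobolev i).1
  have h12 : (12 : ℝ) ∈ Icc (0 : ℝ) 12 := by simp
  have congrInt : ∀ {f g : ℝ → ℝ} {t : ℝ}, t ∈ Icc (0 : ℝ) 12 →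
      (∀ s ∈ Icc (0 : ℝ) 12, f s = g s) →
      ∫ s in (0 : ℝ)..t, f s = ∫ s in (0 : ℝ)..t, g s := by
    intro f g t ht hfg
    refine intervalIntegral.integral_congr fun s hs => hfg s ?_
    rw [uIcc_of_le ht.1] at hs
    exact ⟨hs.1, hs.2.trans ht.2⟩
  have e6 : ∀ t ∈ Icc (0 : ℝ) 12, x 5 t = G₆ u t := fun t ht => by
    rw [eq_primitive_of_ae_hasDerivAt (hac 5) hx.ode₆ ht, hx.initial 5]
    simp [G₆]
  have e3 : ∀ t ∈ Icc (0 : ℝ) 12, x 2 t = G₃ u t := fun t ht => by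
    rw [eq_primitive_of_ae_hasDerivAt (hac 2) hx.ode₃ ht, hx.initial 2, congrInt ht e6]
    simp [G₃]
  have e4 : ∀ t ∈ Icc (0 : ℝ) 12, x 3 t = G₄ u t := fun t ht => by
    rw [eq_primitive_of_ae_hasDerivAt (hac 3) hx.ode₄ ht, hx.initial 3,
      congrInt ht fun s hs => by rw [e3 s hs]]
    simp [G₄]
  have e5 : ∀ t ∈ Icc (0 : ℝ) 12, x 4 t = G₅ u t := fun t ht => by
    rw [eq_primitive_of_ae_hasDerivAt (hac 4) hx.ode₅ ht, hx.initial 4,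
      congrInt ht fun s hs => by rw [e3 s hs]]
    simp [G₅]
  have e1 : x 0 12 = G₁ u 12 := by
    rw [eq_primitive_of_ae_hasDerivAt (hac 0) hx.ode₁ h12, hx.initial 0, congrInt h12 e4]
    simp [G₁]
  have e2 : x 1 12 = G₂ u 12 := by
    rw [eq_primitive_of_ae_hasDerivAt (hac 1) hx.ode₂ h12, hx.initial 1, congrInt h12 e5]
    simp [G₂]
  rw [h_eq_zero_iff, ← e1, ← e2, ← e3 12 h12, ← e4 12 h12, ← e5 12 h12, ← e6 12 h12]
  simp only [hx.final, and_self]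

theorem h_eq_zero_iff_exists_isTrajectory : h u = 0 ↔ ∃ x, IsTrajectory u x :=
  ⟨exists_isTrajectory_of_h_eq_zero u, fun ⟨_, hx⟩ => h_eq_zero_of_isTrajectory u hx⟩

end State

/-! ### Weak continuity of the endpoint map on the box -/

section UniformConvergence

variable {ι : Type*} {l : Filter ι} {F : ι → ℝ → ℝ} {F₀ : ℝ → ℝ}

/-- Pointwise convergence of functions with a common Lipschitz constant on `[0, 12]` is uniform. -/
theorem tendstoUniformlyOn_of_lipschitz {C : ℝ}
    (hp : ∀ t ∈ Icc (0 : ℝ) 12, Tendsto (fun i => F i t) l (𝓝 (F₀ t)))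
    (hF : ∀ᶠ i in l, ∀ s ∈ Icc (0 : ℝ) 12, ∀ t ∈ Icc (0 : ℝ) 12, |F i t - F i s| ≤ C * |t - s|)
    (hF₀ : ∀ s ∈ Icc (0 : ℝ) 12, ∀ t ∈ Icc (0 : ℝ) 12, |F₀ t - F₀ s| ≤ C * |t - s|) :
    TendstoUniformlyOn F F₀ l (Icc 0 12) := by
  have hC : 0 ≤ C := by
    have := (abs_nonneg _).trans (hF₀ 0 (by simp) 1 (by norm_num))
    simpa using this
  rw [Metric.tendstoUniformlyOn_iff]
  intro ε hε
  -- compare on a finite net that is fine enough for the Lipschitz constant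
  obtain ⟨T, hTI, hTfin, hTcov⟩ := finite_cover_balls_of_compact
    (isCompact_Icc (a := (0 : ℝ)) (b := 12)) (e := ε / (3 * (C + 1))) (by positivity)
  have hnet : ∀ᶠ i in l, ∀ s ∈ T, |F i s - F₀ s| < ε / 3 := by
    refine (Set.Finite.eventually_all hTfin).2 fun s hs => ?_
    simpa [Real.dist_eq] using (Metric.tendsto_nhds.1 (hp s (hTI hs))) (ε / 3) (by positivity)
  filter_upwards [hF, hnet] with i hi hnet t ht
  obtain ⟨s, hs, hts⟩ := mem_iUnion₂.1 (hTcov ht)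
  have hsI := hTI hs
  have hsmall : C * |t - s| ≤ ε / 3 := by
    rw [Metric.mem_ball, Real.dist_eq, lt_div_iff₀ (by positivity)] at hts
    nlinarith [abs_nonneg (t - s)]
  have h1 := hi s hsI t ht
  have h2 := hnet s hs
  have h3 := hF₀ s hsI t ht
  rw [Real.dist_eq]
  rw [abs_le] at h1 h3
  rw [abs_lt] at h2 ⊢
  constructor <;> linarith [h1.1, h1.2, h2.1, h2.2, h3.1, h3.2]

theorem tendstoUniformlyOn_primitive (c : ℝ) (hF : ∀ i, ContinuousOn (F i) (Icc 0 12))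
    (hF₀ : ContinuousOn F₀ (Icc 0 12)) (hlim : TendstoUniformlyOn F F₀ l (Icc 0 12)) :
    TendstoUniformlyOn (fun i t => c + ∫ s in (0 : ℝ)..t, F i s)
      (fun t => c + ∫ s in (0 : ℝ)..t, F₀ s) l (Icc 0 12) := by
  have h0 : (0 : ℝ) ∈ Icc (0 : ℝ) 12 := by simp
  rw [Metric.tendstoUniformlyOn_iff] at hlim ⊢
  intro ε hε
  -- over an interval of length at most `12` the error is at most `12 ε / 13 < ε`
  filter_upwards [hlim (ε / 13) (by positivity)] with i hi t ht
  rw [Real.dist_eq, add_sub_add_left_eq_sub, ← intervalIntegral.integral_sub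
    (intervalIntegrable_of_memLp (memLp_of_continuousOn hF₀) h0 ht)
    (intervalIntegrable_of_memLp (memLp_of_continuousOn (hF i)) h0 ht)]
  have hb : ∀ᵐ s ∂timeMeasure, |F₀ s - F i s| ≤ ε / 13 := by
    rw [ae_restrict_iff' measurableSet_Icc]
    exact Eventually.of_forall fun s hs => (hi s hs).le
  have := abs_integral_le_of_ae hb h0 ht
  rw [sub_zero, abs_of_nonneg ht.1] at this
  nlinarith [ht.2]

end UniformConvergence

/-- On `[0, t]`, integration against a square integrable function is a continuous linear functional
of `L²`. -/
theorem exists_dual_eq_integral_mul {w : ℝ → ℝ} (hw : MemLp w 2 timeMeasure) {t : ℝ}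
    (ht : t ∈ Icc (0 : ℝ) 12) :
    ∃ m : StrongDual ℝ L2, ∀ v : L2, m v = ∫ s in (0 : ℝ)..t, v s * w s := by
  have hwI := hw.indicator (measurableSet_Ioc (a := (0 : ℝ)) (b := t))
  refine ⟨innerSL ℝ hwI.toLp, fun v => ?_⟩
  rw [innerSL_apply_apply, L2.inner_def, intervalIntegral.integral_of_le ht.1]
  have hres : volume.restrict (Ioc 0 t) = timeMeasure.restrict (Ioc 0 t) := by
    rw [Measure.restrict_restrict measurableSet_Ioc, inter_eq_self_of_subset_left]
    exact Ioc_subset_Icc_self.trans (Icc_subset_Icc_right ht.2)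
  rw [hres, ← integral_indicator measurableSet_Ioc]
  refine integral_congr_ae ?_
  filter_upwards [hwI.coeFn_toLp] with s hs
  rw [hs]
  by_cases hst : s ∈ Ioc 0 t <;> simp [hst]

theorem abs_thrust_le {u : Control} (hu : u ∈ box) :
    ∀ᵐ t ∂timeMeasure, |u.1 t + u.2 t| ≤ 1.2 := by
  filter_upwards [hu] with t ht
  have := abs_add_le (u.1 t) (u.2 t)
  linarith [ht.1, ht.2]

theorem abs_turning_le {u : Control} (hu : u ∈ box) :
    ∀ᵐ t ∂timeMeasure, |0.2 * (u.1 t - u.2 t)| ≤ 1.2 := by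
  filter_upwards [hu] with t ht
  have := abs_sub (u.1 t) (u.2 t)
  rw [abs_mul, abs_of_pos (by norm_num)]
  linarith [ht.1, ht.2]

section WeakLimit

variable {l : Filter Control} {u₀ : Control}
  (hl : ∀ m : StrongDual ℝ Control, Tendsto m l (𝓝 (m u₀)))

include hl in
/-- The control enters these integrals linearly, so they converge along weakly convergent filters. -/
theorem tendsto_integral_mul {w : ℝ → ℝ} (hw : MemLp w 2 timeMeasure) (a b : ℝ) {t : ℝ}
    (ht : t ∈ Icc (0 : ℝ) 12) :
    Tendsto (fun u : Control => ∫ s in (0 : ℝ)..t, (a * u.1 s + b * u.2 s) * w s) l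
      (𝓝 (∫ s in (0 : ℝ)..t, (a * u₀.1 s + b * u₀.2 s) * w s)) := by
  have h0 : (0 : ℝ) ∈ Icc (0 : ℝ) 12 := by simp
  obtain ⟨m, hm⟩ := exists_dual_eq_integral_mul hw ht
  have hint : ∀ v : L2, IntervalIntegrable (fun s => v s * w s) volume 0 t := fun v => by
    have : IntegrableOn (fun s => v s * w s) (Icc 0 12) := (Lp.memLp v).integrable_mul hw
    exact (this.mono_set (uIcc_subset_Icc h0 ht)).intervalIntegrable
  have key : ∀ u : Control, ∫ s in (0 : ℝ)..t, (a * u.1 s + b * u.2 s) * w s =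
      (a • m.comp (ContinuousLinearMap.fst ℝ L2 L2) +
        b • m.comp (ContinuousLinearMap.snd ℝ L2 L2)) u := by
    intro u
    simp only [add_apply, smul_apply,
      ContinuousLinearMap.comp_apply, ContinuousLinearMap.coe_fst', ContinuousLinearMap.coe_snd',
      hm, smul_eq_mul]
    rw [← intervalIntegral.integral_const_mul, ← intervalIntegral.integral_const_mul,
      ← intervalIntegral.integral_add ((hint u.1).const_mul a) ((hint u.2).const_mul b)]
    refine intervalIntegral.integral_congr fun s _ => ?_
    ring
  simp only [key]
  exact hl _

variable (hbox : ∀ᶠ u in l, u ∈ box) (hu₀ : u₀ ∈ box)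

include hl hbox hu₀

theorem tendstoUniformlyOn_G₆ : TendstoUniformlyOn G₆ (G₆ u₀) l (Icc 0 12) := by
  refine tendstoUniformlyOn_of_lipschitz (C := 1.2) (fun t ht => ?_) ?_ ?_
  · have := tendsto_integral_mul hl (memLp_const (1 : ℝ)) 0.2 (-0.2) ht
    convert this using 2
    · refine intervalIntegral.integral_congr fun s _ => ?_
      ring
    · refine intervalIntegral.integral_congr fun s _ => ?_
      ring
  · filter_upwards [hbox] with u hu s hs t ht
    exact abs_primitive_sub_le (memLp_turning u) (abs_turning_le hu) hs ht
  · exact fun s hs t ht => abs_primitive_sub_le (memLp_turning u₀) (abs_turning_le hu₀) hs ht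

theorem tendstoUniformlyOn_G₃ : TendstoUniformlyOn G₃ (G₃ u₀) l (Icc 0 12) :=
  tendstoUniformlyOn_primitive _ continuousOn_G₆ (continuousOn_G₆ u₀)
    (tendstoUniformlyOn_G₆ hl hbox hu₀)

/-- The velocities depend weakly continuously on the control: the orientation converges uniformly,
and against the fixed limiting orientation the thrust is integrated linearly. -/
theorem tendsto_velocity {σ : ℝ → ℝ} (hσ : LipschitzWith 1 σ) {t : ℝ}
    (ht : t ∈ Icc (0 : ℝ) 12) :
    Tendsto (fun u => velocity σ u t) l (𝓝 (velocity σ u₀ t)) := by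
  have h0 : (0 : ℝ) ∈ Icc (0 : ℝ) 12 := by simp
  have hw : ContinuousOn (fun s => σ (G₃ u₀ s)) (Icc 0 12) :=
    hσ.continuous.comp_continuousOn (continuousOn_G₃ u₀)
  have hlin := tendsto_integral_mul hl (memLp_of_continuousOn hw) 1 1 ht
  simp only [one_mul] at hlin
  have hdiff : Tendsto (fun u => velocity σ u t -
      ∫ s in (0 : ℝ)..t, (u.1 s + u.2 s) * σ (G₃ u₀ s)) l (𝓝 0) := by
    rw [Metric.tendsto_nhds]
    intro ε hε
    -- with the thrust bounded by `1.2`, the error is at most `12 * 1.2 * ε / 20 < ε`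
    filter_upwards [hbox, Metric.tendstoUniformlyOn_iff.1 (tendstoUniformlyOn_G₃ hl hbox hu₀)
      (ε / 20) (by positivity)] with u hu hunif
    have hb : ∀ᵐ s ∂timeMeasure, |(u.1 s + u.2 s) * σ (G₃ u s) -
        (u.1 s + u.2 s) * σ (G₃ u₀ s)| ≤ 1.2 * (ε / 20) := by
      filter_upwards [abs_thrust_le hu, ae_restrict_mem measurableSet_Icc] with s hs hsI
      rw [← mul_sub, abs_mul]
      refine mul_le_mul hs ?_ (abs_nonneg _) (by norm_num)
      have h1 := hσ.dist_le_mul (G₃ u s) (G₃ u₀ s)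
      have h2 := hunif s hsI
      rw [dist_comm] at h2
      rw [NNReal.coe_one, one_mul, Real.dist_eq] at h1
      exact h1.trans h2.le
    have := abs_integral_le_of_ae hb h0 ht
    rw [intervalIntegral.integral_sub
      (intervalIntegrable_of_memLp (memLp_acceleration u hσ.continuous) h0 ht)
      (intervalIntegrable_of_memLp (memLp_mul_of_continuousOn (memLp_thrust u) hw) h0 ht),
      sub_zero, abs_of_nonneg ht.1] at this
    rw [Real.dist_eq, sub_zero]
    refine this.trans_lt ?_
    nlinarith [ht.2]
  simpa using! hdiff.add hlin

theorem tendstoUniformlyOn_velocity {σ : ℝ → ℝ} (hσ : LipschitzWith 1 σ)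
    (hσ1 : ∀ x, |σ x| ≤ 1) : TendstoUniformlyOn (velocity σ) (velocity σ u₀) l (Icc 0 12) := by
  have hb : ∀ u ∈ box, ∀ᵐ s ∂timeMeasure, |(u.1 s + u.2 s) * σ (G₃ u s)| ≤ 1.2 := by
    intro u hu
    filter_upwards [abs_thrust_le hu] with s hs
    rw [abs_mul]
    nlinarith [abs_nonneg (u.1 s + u.2 s), hσ1 (G₃ u s)]
  refine tendstoUniformlyOn_of_lipschitz (C := 1.2)
    (fun t ht => tendsto_velocity hl hbox hu₀ hσ ht) ?_ ?_
  · filter_upwards [hbox] with u hu s hs t ht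
    exact abs_primitive_sub_le (memLp_acceleration u hσ.continuous) (hb u hu) hs ht
  · exact fun s hs t ht =>
      abs_primitive_sub_le (memLp_acceleration u₀ hσ.continuous) (hb u₀ hu₀) hs ht

/-- The endpoint map is weakly continuous on the box, stated for arbitrary filters because the weak
topology need not be treated sequentially. -/
theorem tendsto_h (i : Fin 6) : Tendsto (fun u => h u i) l (𝓝 (h u₀ i)) := by
  have h12 : (12 : ℝ) ∈ Icc (0 : ℝ) 12 := by simp
  have t4 := tendstoUniformlyOn_velocity hl hbox hu₀ Real.lipschitzWith_cos Real.abs_cos_le_one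
  have t5 := tendstoUniformlyOn_velocity hl hbox hu₀ Real.lipschitzWith_sin Real.abs_sin_le_one
  have t1 := tendstoUniformlyOn_primitive (-10)
    (fun u => continuousOn_velocity u Real.continuous_cos)
    (continuousOn_velocity u₀ Real.continuous_cos) t4
  have t2 := tendstoUniformlyOn_primitive (-10)
    (fun u => continuousOn_velocity u Real.continuous_sin)
    (continuousOn_velocity u₀ Real.continuous_sin) t5
  fin_cases i
  · exact t1.tendsto_at h12
  · exact t2.tendsto_at h12
  · exact (tendstoUniformlyOn_G₃ hl hbox hu₀).tendsto_at h12
  · exact t4.tendsto_at h12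
  · exact t5.tendsto_at h12
  · exact (tendstoUniformlyOn_G₆ hl hbox hu₀).tendsto_at h12

end WeakLimit

/-! ### Level sets of the objective function and the box -/

theorem objective_eq (u : Control) : objective u = ((‖u.1‖ ^ 2 + ‖u.2‖ ^ 2 : ℝ) : EReal) := by
  have hnorm : ∀ v : L2, ‖v‖ ^ 2 = ∫ t, v t ^ 2 ∂timeMeasure := fun v => by
    rw [← real_inner_self_eq_norm_sq, L2.inner_def]
    refine integral_congr_ae (Eventually.of_forall fun t => ?_)
    simp [sq]
  unfold objective
  rw [hnorm, hnorm, ← integral_add (Lp.memLp u.1).integrable_sq (Lp.memLp u.2).integrable_sq,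
    intervalIntegral.integral_of_le (by norm_num), integral_Icc_eq_integral_Ioc]

theorem objective_le_iff (u : Control) (α : ℝ) :
    objective u ≤ (α : EReal) ↔ ‖u.1‖ ^ 2 + ‖u.2‖ ^ 2 ≤ α := by
  rw [objective_eq, EReal.coe_le_coe_iff]

theorem objective_ne_bot (u : Control) : objective u ≠ ⊥ := by
  rw [objective_eq]
  exact EReal.coe_ne_bot _

theorem objective_lt_top (u : Control) : objective u < ⊤ := by
  rw [objective_eq]
  exact EReal.coe_lt_top _

theorem convex_level (α : ℝ) : Convex ℝ {u : Control | objective u ≤ (α : EReal)} := by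
  simp only [objective_le_iff]
  have hsq : ConvexOn ℝ univ fun v : L2 => ‖v‖ ^ 2 :=
    convexOn_univ_norm.pow (fun v _ => norm_nonneg v) 2
  have := (hsq.comp_linearMap (LinearMap.fst ℝ L2 L2)).add
    (hsq.comp_linearMap (LinearMap.snd ℝ L2 L2))
  simpa using! this.convex_le α

theorem isClosed_level (α : ℝ) : IsClosed {u : Control | objective u ≤ (α : EReal)} := by
  simp only [objective_le_iff]
  exact isClosed_le (by fun_prop) continuous_const

/-- A level set is a weakly closed part of a product of closed balls of radius `√α`. For negative `α`
the radius is `0` and the level set is empty. -/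
theorem isWeaklyCompact_level (α : ℝ) :
    IsWeaklyCompact {u : Control | objective u ≤ (α : EReal)} := by
  refine isWeaklyCompact_of_subset (isWeaklyCompact_prod_closedBall (√α)) ?_
    (isClosed_toWeakSpace_image (convex_level α) (isClosed_level α))
  intro u hu
  rw [mem_ofPred_eq, objective_le_iff] at hu
  simp only [mem_prod, mem_closedBall_zero_iff]
  exact ⟨Real.le_sqrt_of_sq_le (by nlinarith [sq_nonneg ‖u.2‖]),
    Real.le_sqrt_of_sq_le (by nlinarith [sq_nonneg ‖u.1‖])⟩

theorem convex_box : Convex ℝ box := by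
  intro u hu v hv a b ha hb hab
  have h1 := Lp.coeFn_add (a • u.1) (b • v.1)
  have h2 := Lp.coeFn_add (a • u.2) (b • v.2)
  filter_upwards [hu, hv, h1, h2, Lp.coeFn_smul a u.1, Lp.coeFn_smul b v.1,
    Lp.coeFn_smul a u.2, Lp.coeFn_smul b v.2] with t hut hvt e1 e2 e3 e4 e5 e6
  have hball : ∀ c : ℝ, Convex ℝ {r : ℝ | |r| ≤ c} := fun c => by
    simpa [abs_le, Icc_def] using! convex_Icc (-c) c
  simp only [Prod.fst_add, Prod.snd_add, Prod.smul_fst, Prod.smul_snd, e1, e2, Pi.add_apply,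
    e3, e4, e5, e6, Pi.smul_apply]
  exact ⟨hball 0.8 hut.1 hvt.1 ha hb hab, hball 0.4 hut.2 hvt.2 ha hb hab⟩

theorem isClosed_box : IsClosed box := by
  -- the bounds are order intervals of the Banach lattice `L²`
  have hIcc : ∀ (v : L2) (c : ℝ), (∀ᵐ t ∂timeMeasure, |v t| ≤ c) ↔
      v ∈ Icc (Lp.const 2 timeMeasure (-c)) (Lp.const 2 timeMeasure c) := by
    intro v c
    rw [mem_Icc, ← Lp.coeFn_le, ← Lp.coeFn_le]
    simp only [abs_le, eventually_and]
    refine and_congr ?_ ?_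
    · refine eventually_congr ?_
      filter_upwards [Lp.coeFn_const (p := 2) (μ := timeMeasure) (c := -c)] with t ht
      rw [ht, Function.const_apply]
    · refine eventually_congr ?_
      filter_upwards [Lp.coeFn_const (p := 2) (μ := timeMeasure) (c := c)] with t ht
      rw [ht, Function.const_apply]
  have hbox : box = Icc (Lp.const 2 timeMeasure (-0.8 : ℝ)) (Lp.const 2 timeMeasure 0.8) ×ˢ
      Icc (Lp.const 2 timeMeasure (-0.4 : ℝ)) (Lp.const 2 timeMeasure 0.4) := by
    ext u
    rw [mem_prod, ← hIcc, ← hIcc, ← eventually_and]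
    rfl
  rw [hbox]
  exact isClosed_Icc.prod isClosed_Icc

/-! ### The parametrization -/

theorem parametrization_of_mem {u : Control} {z : Param} (hz : h u = z) (hu : u ∈ box) :
    parametrization (u, z) = objective u := by
  simp [parametrization, indicatorFun, hz, hu]

theorem parametrization_of_notMem {u : Control} {z : Param} (hu : ¬(h u = z ∧ u ∈ box)) :
    parametrization (u, z) = ⊤ := by
  have : u ∉ h ⁻¹' {z} ∩ box := hu
  simp [parametrization, indicatorFun, this, EReal.add_top_of_ne_bot (objective_ne_bot u)]

theorem parametrization_le_iff (p : Control × Param) (α : ℝ) :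
    parametrization p ≤ (α : EReal) ↔ objective p.1 ≤ (α : EReal) ∧ h p.1 = p.2 ∧ p.1 ∈ box := by
  obtain ⟨u, z⟩ := p
  by_cases hu : h u = z ∧ u ∈ box
  · rw [parametrization_of_mem hu.1 hu.2]
    exact (and_iff_left hu).symm
  · rw [parametrization_of_notMem hu]
    exact ⟨fun hle => absurd hle (by simp), fun hle => absurd hle.2 hu⟩

theorem parametrization_ne_bot (p : Control × Param) : parametrization p ≠ ⊥ := by
  obtain ⟨u, z⟩ := p
  by_cases hu : h u = z ∧ u ∈ box
  · rw [parametrization_of_mem hu.1 hu.2]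
    exact objective_ne_bot u
  · rw [parametrization_of_notMem hu]
    simp

/-- The level sets of the parametrization are the parts of the graph of `h` over the weakly closed sets
`{φ ≤ α} ∩ K₂`, on which `h` is weakly continuous. -/
theorem weaklyLSC_parametrization : WeaklyLSC parametrization := by
  refine weaklyLSC_of_isClosed (fun α => ?_) parametrization_ne_bot
  rw [isClosed_iff_forall_filter]
  intro x₀ l hne hl hx₀
  obtain ⟨p₀, rfl⟩ := (toWeakSpace ℝ (Control × Param)).surjective x₀
  let S : Set Control := {u | objective u ≤ (α : EReal)} ∩ box
  have hS : IsClosed (toWeakSpace ℝ Control '' S) := isClosed_toWeakSpace_image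
    ((convex_level α).inter convex_box) ((isClosed_level α).inter isClosed_box)
  have hev : ∀ᶠ x in l, parametrization ((toWeakSpace ℝ (Control × Param)).symm x) ≤
      (α : EReal) := by
    refine mem_of_superset (le_principal_iff.1 hl) ?_
    rintro _ ⟨p, hp, rfl⟩
    simpa using! hp
  simp only [parametrization_le_iff] at hev
  have hfst : Tendsto (WeakSpace.map (ContinuousLinearMap.fst ℝ Control Param)) l
      (𝓝 (toWeakSpace ℝ Control p₀.1)) :=
    ((WeakSpace.map (ContinuousLinearMap.fst ℝ Control Param)).continuous.tendsto _).mono_left hx₀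
  have hmem : toWeakSpace ℝ Control p₀.1 ∈ toWeakSpace ℝ Control '' S := by
    refine hS.mem_of_tendsto hfst ?_
    filter_upwards [hev] with x hx
    exact ⟨_, ⟨hx.1, hx.2.2⟩, rfl⟩
  obtain ⟨u', ⟨hu1, hu2⟩, hu'⟩ := hmem
  obtain rfl : u' = p₀.1 := (toWeakSpace ℝ Control).injective hu'
  have hfun : ∀ m : StrongDual ℝ (Control × Param),
      Tendsto (fun x => m ((toWeakSpace ℝ (Control × Param)).symm x)) l (𝓝 (m p₀)) := fun m =>
    ((continuous_weakSpace_eval m).tendsto _).mono_left hx₀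
  have hh : h p₀.1 = p₀.2 := by
    ext i
    have h1 : Tendsto (fun x => h ((toWeakSpace ℝ (Control × Param)).symm x).1 i) l
        (𝓝 (h p₀.1 i)) := by
      refine (tendsto_h (l := l.map fun x => ((toWeakSpace ℝ (Control × Param)).symm x).1)
        (fun m => ?_) ?_ hu2 i)
      · exact hfun (m.comp (ContinuousLinearMap.fst ℝ Control Param))
      · exact hev.mono fun x hx => hx.2.2
    have h2 := hfun ((EuclideanSpace.proj i : Param →L[ℝ] ℝ).comp
      (ContinuousLinearMap.snd ℝ Control Param))
    refine tendsto_nhds_unique h1 (h2.congr' ?_)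
    filter_upwards [hev] with x hx
    rw [hx.2.1]
    rfl
  exact ⟨p₀, (parametrization_le_iff p₀ α).2 ⟨hu1, hh, hu2⟩, rfl⟩

/-- The level sets of `φ` serve for all parameters at once, since the indicator is nonnegative. -/
theorem weaklyLevelCompact_parametrization : WeaklyLevelCompact parametrization := by
  intro z₀ α
  refine ⟨univ, ?_, mem_univ _, _, isWeaklyCompact_level α, fun z _ u hu => ?_⟩
  · unfold IsWeaklyOpen
    rw [image_univ, (toWeakSpace ℝ Param).surjective.range_eq]
    exact isOpen_univ
  · exact ((parametrization_le_iff _ α).1 hu).1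

theorem zero_mem_box : (0 : Control) ∈ box := by
  have := Lp.coeFn_zero ℝ 2 timeMeasure
  filter_upwards [this] with t ht
  simp only [Prod.fst_zero, Prod.snd_zero, ht, Pi.zero_apply, abs_zero]
  norm_num

end FFR

theorem corollary6p3 :
    -- `h` encodes the state equations together with their boundary conditions
    (∀ u : FFR.Control, FFR.h u = 0 ↔ ∃ x, FFR.IsTrajectory u x) ∧
    -- the two expressions for the parametrization agree
    (∀ (u : FFR.Control) (z : FFR.Param), FFR.parametrization (u, z) =
      FFR.objective u + indicatorFun {z} (FFR.h u) + indicatorFun FFR.box u) ∧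
    -- it is a dualizing parametrization of the free-flying robot problem
    IsDualizingParametrization FFR.objective FFR.feasible FFR.parametrization ∧
    AssumptionH0 FFR.objective ∧
    AssumptionH1 FFR.objective ∧
    AssumptionH2 FFR.parametrization := by
  refine ⟨FFR.h_eq_zero_iff_exists_isTrajectory, fun u z => ?_, fun u => ?_,
    ⟨⟨FFR.objective_ne_bot, 0, FFR.objective_lt_top 0⟩, ?_⟩, FFR.isWeaklyCompact_level,
    ⟨⟨FFR.parametrization_ne_bot, (0, FFR.h 0), ?_⟩, FFR.weaklyLSC_parametrization,
      FFR.weaklyLevelCompact_parametrization⟩⟩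
  · by_cases hz : FFR.h u = z <;> by_cases hu : u ∈ FFR.box <;>
      simp [FFR.parametrization, indicatorFun, hz, hu,
        EReal.add_top_of_ne_bot (FFR.objective_ne_bot u)]
  · have hset : FFR.h ⁻¹' {0} ∩ FFR.box = FFR.feasible := by
      ext v
      rw [mem_inter_iff, mem_preimage, mem_singleton_iff,
        FFR.h_eq_zero_iff_exists_isTrajectory, and_comm]
      rfl
    simp only [FFR.parametrization, hset]
  · exact weaklyLSC_of_isClosed (fun α => isClosed_toWeakSpace_image (FFR.convex_level α)
      (FFR.isClosed_level α)) FFR.objective_ne_bot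
  · rw [FFR.parametrization_of_mem rfl FFR.zero_mem_box]
    exact FFR.objective_lt_top 0
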